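/- **Setting.** A *physical system* consists of a nonempty set $\mathcal O$ of observables, a set $\mathcal S$ of states containing a distinguished null state $0$ and at least one other element, for each $\rho\in\mathcal S$ and $A\in\mathcal O$ a Borel measure $P_\rho^A=P_\rho(\,\cdot\,;A)$ on $\mathbb R$ (a probability measure if $\rho\neq 0$, the zero measure if $\rho=0$), and for each Borel set $\Delta$ and $A\in\mathcal O$ an update map $T_{(\Delta;A)}:\mathcal S\to\mathcal S$ with $T_{(\emptyset;A)}(\rho)=0$ and $T_{(\Delta;A)}(0)=0$. Below, "state" means non-null state, $0/0=0$, and $\alpha$ abbreviates $\{\alpha\}$ in $P$ and $T$. The *spectrum* $\sigma(A)$ is the intersection of all Borel sets $\Delta$ with $P_\rho(\Delta;A)=1$ for all states $\rho$. The system is assumed to be *finite-dimensional*: each $\sigma(A)$ is finite and has probability one in every state, and $n=\sup_A|\sigma(A)|<\infty$. $A$ is *nondegenerate* if $|\sigma(A)|=n$. For $f:\sigma(A)\to\sigma(B)$ write $B=f(A)$ if $P_\rho(\Sigma;B)=P_\rho(f^{-1}(\Sigma);A)$ for all states $\rho$ and all $\Sigma\subset\sigma(B)$. Observables $A,B$ are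 *compatible* if $A=f(C)$, $B=g(C)$ for some $C,f,g$. The probability of a sequence of events is $$P_\rho\big((\Delta_1;A_1),\dots,(\Delta_m;A_m)\big)=\prod_{i=1}^m P_{\rho_{i-1}}(\Delta_i;A_i),\qquad \rho_0=\rho,\ \ \rho_i=T_{(\Delta_i;A_i)}(\rho_{i-1}),$$ and $p_\rho(\alpha_1,\dots,\alpha_m;A_1,\dots,A_m)$ denotes this number for $\Delta_i=\{\alpha_i\}$. A *completely mixed state* is a state $\omega$ with $P_\omega(\alpha;A)=1/n$ for all nondegenerate $A$ and $\alpha\in\sigma(A)$. A *rank-one projection* is an observable $E=\chi_{\{\alpha\}}(A)$ with $A$ nondegenerate and $\alpha\in\sigma(A)$; a *pure state* is a state $T_{(1;E)}(\omega)$ with $E$ a rank-one projection. For $E=\chi_\Delta(C)$ and $F=\chi_\Sigma(C)$ put $E\circ F=\chi_{\Delta\cap\Sigma}(C)$. The system is assumed to satisfy the following postulates (all events $(\Delta;A)$ have $\Delta\subset\sigma(A)$). 1. *Separability.* If $P_\rho^A=P_\rho^B$ for all states $\rho$, then $A=B$; if $P_\rho^A=P_{\rho'}^A$ for all observables $A$,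 then $\rho=\rho'$. 2. *Subjective update.* The (non-null) states form a convex set on which $\rho\mapsto P_\rho$ preserves convex combinations, and for every event $(\Delta;A)$, every state $\rho$ and every nonempty sequence $s$ of events, $P_{T_{(\Delta;A)}(\rho)}(s)=\sum_{\alpha\in\Delta}\frac{P_\rho(\alpha;A)}{P_\rho(\Delta;A)}P_{T_{(\alpha;A)}(\rho)}(s)$. 3. *Self-compatibility.* For $\alpha,\alpha'\in\sigma(A)$ and $\Delta\subset\sigma(A)$: $P_{T_{(\alpha;A)}(\rho)}(\Delta;A)=P_\rho(\Delta\cap\{\alpha\};A)/P_\rho(\alpha;A)$ for every state $\rho$, and $T_{(\alpha;A)}\circ T_{(\alpha';A)}$ is $T_{(\alpha;A)}$ if $\alpha=\alpha'$ and the null map otherwise. 4. *Observables and states.* Each degenerate observable is $f(C)$ for a nondegenerate $C$ and a non-injective $f$; for nondegenerate $A$ and every real function $f$ on $\sigma(A)$ there is an observable $f(A)$; a completely mixed state $\omega$ exists, and every state is a convex combination of states obtained from $\omega$ by finitely many (possibly no) updates $T_{(\Delta;A)}$. 5. *Compatibility.* If $A=f(C)$ and $B=g(C)$, then $P_\rho((\Delta;A),(\Sigma;B))=P_\rho(f^{-1}(\Delta)\cap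 g^{-1}(\Sigma);C)$ for all states $\rho$, $\Delta\subset\sigma(A)$, $\Sigma\subset\sigma(B)$; and $T_{(\alpha;A)}\circ T_{(\beta;B)}=T_{(1;\chi_{\{\alpha\}}(A)\circ\chi_{\{\beta\}}(B))}$ for compatible $A,B$ and $\alpha\in\sigma(A)$, $\beta\in\sigma(B)$. 6. *Commutativity.* If $P_\rho(\Delta;A)P_{T_{(\Delta;A)}(\rho)}(\Sigma;B)=P_\rho(\Sigma;B)P_{T_{(\Sigma;B)}(\rho)}(\Delta;A)$ for all states $\rho$, $\Delta\subset\sigma(A)$ and $\Sigma\subset\sigma(B)$, then $A$ and $B$ are compatible. 7. *Eigenstates.* If $F$ is a rank-one projection and $P_{T_{(1;F)}(\omega)}(\alpha;A)=1$ for some $\alpha\in\sigma(A)$, then $F$ and $A$ are compatible; if $A$ is nondegenerate and $P_\rho(\alpha;A)=1$ for some $\alpha\in\sigma(A)$, then $\rho$ is pure. 8. *Symmetry of transition probabilities.* $P_{T_{(1;E)}(\omega)}(1;F)=P_{T_{(1;F)}(\omega)}(1;E)$ for all rank-one projections $E,F$. **Proposition (Local orthogonality).** For each $j\in\{1,\dots,k\}$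 let $(A^{(j)}_1,\dots,A^{(j)}_m)$ be a tuple of pairwise compatible observables and let $\alpha^{(j)}_i\in\sigma(A^{(j)}_i)$ for $i=1,\dots,m$. Suppose that for all distinct $j,j'\in\{1,\dots,k\}$ there is $i\in\{1,\dots,m\}$ with $A^{(j)}_i=A^{(j')}_i$ and $\alpha^{(j)}_i\neq\alpha^{(j')}_i$. Then for every state $\rho$, $$\sum_{j=1}^k p_\rho\big(\alpha^{(j)}_1,\dots,\alpha^{(j)}_m;A^{(j)}_1,\dots,A^{(j)}_m\big)\le 1 .$$ -/

import Mathlib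

open MeasureTheory
open scoped NNReal

/-- A physical system: observables, states (among them a null state without physical meaning),
for each state and observable a Borel measure on `ℝ` (a probability measure if the state is not
null, the null measure otherwise), and for each observable event `(Δ; A)` a state update.
The update is a function of an arbitrary set `Δ` of reals only for convenience: below it is used
at finite sets. -/
structure PhysicalSystem (Obs : Type*) (State : Type*) where
  /-- the null state -/
  null : State
  /-- `prob ρ A` is the measure `P_ρ( · ; A)` -/
  prob : State → Obs → Measure ℝ
  /-- `update Δ A` is the map `T_(Δ; A)` -/
  update : Set ℝ → Obs → State → State
  nonempty_obs : Nonempty Obs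
  exists_ne_null : ∃ ρ, ρ ≠ null
  prob_null : ∀ A, prob null A = 0
  isProbabilityMeasure_prob : ∀ ρ A, ρ ≠ null → IsProbabilityMeasure (prob ρ A)
  update_empty : ∀ A ρ, update ∅ A ρ = null
  update_null : ∀ Δ A, update Δ A null = null

namespace PhysicalSystem

section

variable {Obs State : Type*} (S : PhysicalSystem Obs State)

/-- The spectrum `σ(A)`: the intersection of all Borel sets that have probability one in every
(non-null) state. -/
def spectrum (A : Obs) : Set ℝ :=
  ⋂₀ {Δ | MeasurableSet Δ ∧ ∀ ρ, ρ ≠ S.null → S.prob ρ A Δ = 1}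

/-- The dimension: the supremum of the cardinalities of the spectra. -/
noncomputable def dim : ℕ∞ := ⨆ A, (S.spectrum A).encard

/-- Finite-dimensional systems: every spectrum is a finite set, and the dimension is finite. That
the values of an observable lie in its spectrum with probability one, which is part of the meaning
of the spectrum as the smallest set containing all possible values, does not follow from
`spectrum` being finite (the intersection above is empty for a diffuse measure), and is recorded. -/
structure IsFiniteDimensional : Prop where
  finite_spectrum : ∀ A, (S.spectrum A).Finite
  prob_spectrum : ∀ A ρ, ρ ≠ S.null → S.prob ρ A (S.spectrum A) = 1
  dim_lt_top : S.dim < ⊤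

/-- An observable is nondegenerate if its spectrum has `dim` elements. -/
def IsNondegenerate (A : Obs) : Prop := (S.spectrum A).encard = S.dim

/-! ### Sequential events -/

/-- The composite update `T_(Δₘ; Aₘ) ∘ ⋯ ∘ T_(Δ₁; A₁)` of a sequence of events. -/
def seqUpdate : List (Set ℝ × Obs) → State → State
  | [], ρ => ρ
  | e :: l, ρ => seqUpdate l (S.update e.1 e.2 ρ)

/-- The probability of a sequence of events `(Δ₁; A₁), …, (Δₘ; Aₘ)` in the state `ρ`: the product
over `i` of the probability of `(Δᵢ; Aᵢ)` in the state `T_(Δᵢ₋₁; Aᵢ₋₁) ⋯ T_(Δ₁; A₁) ρ`. -/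
noncomputable def seqProb : List (Set ℝ × Obs) → State → ℝ
  | [], _ => 1
  | e :: l, ρ => (S.prob ρ e.2).real e.1 * seqProb l (S.update e.1 e.2 ρ)

/-- The joint sequential probability `p_ρ(α₁, …, αₘ; A₁, …, Aₘ)`. -/
noncomputable def jointProb {m : ℕ} (ρ : State) (α : Fin m → ℝ) (A : Fin m → Obs) : ℝ :=
  S.seqProb (List.ofFn fun i => (({α i} : Set ℝ), A i)) ρ

/-! ### Functional relations, compatibility, commutativity -/

/-- `B = f(A)`: in every state the distribution of `B` on `σ(B)` is the pushforward of the
distribution of `A` on `σ(A)` along `f : σ(A) → σ(B)` (the values of `f` off `σ(A)` play no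
role). -/
def IsFunctionVia (f : ℝ → ℝ) (A B : Obs) : Prop :=
  Set.MapsTo f (S.spectrum A) (S.spectrum B) ∧
    ∀ ρ, ρ ≠ S.null → ∀ Γ ⊆ S.spectrum B,
      (S.prob ρ B).real Γ = (S.prob ρ A).real (S.spectrum A ∩ f ⁻¹' Γ)

/-- Two observables are compatible if they are functions of one observable. -/
def Compatible (A B : Obs) : Prop :=
  ∃ (C : Obs) (f g : ℝ → ℝ), S.IsFunctionVia f C A ∧ S.IsFunctionVia g C B

/-- Two observables commute if they satisfy the Bayes rule. -/
def Commutes (A B : Obs) : Prop :=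
  ∀ ρ, ρ ≠ S.null → ∀ Δ ⊆ S.spectrum A, ∀ Γ ⊆ S.spectrum B,
    (S.prob ρ A).real Δ * (S.prob (S.update Δ A ρ) B).real Γ =
      (S.prob ρ B).real Γ * (S.prob (S.update Γ B ρ) A).real Δ

/-! ### Projections -/

/-- `E = χ_Δ(A)`. -/
def IsChar (Δ : Set ℝ) (A E : Obs) : Prop :=
  Δ ⊆ S.spectrum A ∧ S.IsFunctionVia (Δ.indicator fun _ => 1) A E

/-- `E` is a projection of rank (trace) `k`: it is `χ_Δ(A)` for a nondegenerate `A` and a set `Δ`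
of `k` elements. -/
def IsProjectionOfRank (k : ℕ) (E : Obs) : Prop :=
  ∃ (A : Obs) (Δ : Set ℝ), S.IsNondegenerate A ∧ Δ.encard = k ∧ S.IsChar Δ A E

/-- `G = E ∘ F` for compatible projections `E`, `F`: if `E = χ_Δ(C)` and `F = χ_Γ(C)`, then
`E ∘ F = χ_(Δ ∩ Γ)(C)`. In the systems considered here the choice of `C` makes no difference. -/
def IsProduct (E F G : Obs) : Prop :=
  ∃ (C : Obs) (Δ Γ : Set ℝ), S.IsChar Δ C E ∧ S.IsChar Γ C F ∧ S.IsChar (Δ ∩ Γ) C G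

/-! ### Special states -/

/-- The completely mixed state: uniformly distributed on the spectrum of every nondegenerate
observable. -/
def IsCompletelyMixed (ω : State) : Prop :=
  ω ≠ S.null ∧ ∀ A, S.IsNondegenerate A → ∀ α ∈ S.spectrum A,
    (S.prob ω A).real {α} = 1 / ((S.spectrum A).ncard : ℝ)

/-- States obtained from `ω` by a (possibly empty) sequence of observable events. -/
def IsAccessibleFrom (ω ρ : State) : Prop :=
  ρ ≠ S.null ∧ ∃ l : List (Set ℝ × Obs),
    (∀ e ∈ l, e.1 ⊆ S.spectrum e.2) ∧ ρ = S.seqUpdate l ω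

/-- `ρ` is the convex combination `∑ i, w i • τ i` of non-null states. States are determined by the
probabilities that they assign, and these depend affinely on the state, so convex combinations of
states are expressed through their probability measures. -/
def IsConvexCombination {k : ℕ} (ρ : State) (w : Fin k → ℝ≥0) (τ : Fin k → State) : Prop :=
  ρ ≠ S.null ∧ (∀ i, τ i ≠ S.null) ∧ ∑ i, w i = 1 ∧
    ∀ A, S.prob ρ A = ∑ i, w i • S.prob (τ i) A

/-- Pure states: `T_(1; E) ω` for the completely mixed state `ω` and a rank-one projection `E`. -/
def IsPure (ρ : State) : Prop :=
  ∃ (ω : State) (E : Obs), S.IsCompletelyMixed ω ∧ S.IsProjectionOfRank 1 E ∧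
    ρ = S.update {1} E ω

/-! ### The postulates -/

/-- Observables that no state distinguishes are equal, and states that no observable distinguishes
are equal. -/
def Separability : Prop :=
  (∀ A B, (∀ ρ, ρ ≠ S.null → S.prob ρ A = S.prob ρ B) → A = B) ∧
    ∀ ρ ρ', (∀ A, S.prob ρ A = S.prob ρ' A) → ρ = ρ'

/-- The (non-null) states form a convex set on which `ρ ↦ P_ρ` is affine; and the update by the
event `(Δ; A)` acts on the probability of any sequence of events as the mixture of the updates by
the outcomes `α ∈ Δ`, weighted with their conditional probabilities given `Δ` (with `0 / 0 = 0`). -/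
def SubjectiveUpdate : Prop :=
  (∀ (k : ℕ) (w : Fin k → ℝ≥0) (τ : Fin k → State), (∀ i, τ i ≠ S.null) → ∑ i, w i = 1 →
      ∃ ρ, S.IsConvexCombination ρ w τ) ∧
    ∀ (A : Obs) (Δ : Finset ℝ), (Δ : Set ℝ) ⊆ S.spectrum A → ∀ ρ, ρ ≠ S.null →
      ∀ l : List (Set ℝ × Obs), l ≠ [] → (∀ e ∈ l, e.1 ⊆ S.spectrum e.2) →
        S.seqProb l (S.update Δ A ρ) =
          ∑ α ∈ Δ, (S.prob ρ A).real {α} / (S.prob ρ A).real Δ * S.seqProb l (S.update {α} A ρ)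

/-- Measuring `A` with outcome `α` conditions the distribution of `A` on `{α}` (with `0 / 0 = 0`),
and `T_(α; A) ∘ T_(α'; A)` is `T_(α; A)` if `α = α'` and the null map otherwise. -/
def SelfCompatibility : Prop :=
  ∀ A, ∀ α ∈ S.spectrum A,
    (∀ ρ, ρ ≠ S.null → ∀ Δ ⊆ S.spectrum A,
      (S.prob (S.update {α} A ρ) A).real Δ =
        (S.prob ρ A).real (Δ ∩ {α}) / (S.prob ρ A).real {α}) ∧
    (∀ ρ, S.update {α} A (S.update {α} A ρ) = S.update {α} A ρ) ∧
    ∀ α' ∈ S.spectrum A, α ≠ α' → ∀ ρ, S.update {α} A (S.update {α'} A ρ) = S.null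

/-- Every degenerate observable is a coarse-graining of a nondegenerate one, every function of a
nondegenerate observable is an observable, there is a completely mixed state, and every state is a
convex combination of states accessible from it. -/
def ObservablesAndStates : Prop :=
  (∀ A, ¬ S.IsNondegenerate A → ∃ (C : Obs) (f : ℝ → ℝ),
      S.IsNondegenerate C ∧ S.IsFunctionVia f C A ∧ ¬ Set.InjOn f (S.spectrum C)) ∧
    (∀ A, S.IsNondegenerate A → ∀ f : ℝ → ℝ, ∃ B, S.IsFunctionVia f A B) ∧
    ∃ ω, S.IsCompletelyMixed ω ∧
      ∀ ρ, ρ ≠ S.null → ∃ (k : ℕ) (w : Fin k → ℝ≥0) (τ : Fin k → State),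
        (∀ i, S.IsAccessibleFrom ω (τ i)) ∧ S.IsConvexCombination ρ w τ

/-- If `A = f(C)` and `B = g(C)`, the sequential measure of `(A, B)` is the pushforward of the
distribution of `C` along `(f, g)` (a measure on the finite set `σ(A) × σ(B)`, determined by its
values on boxes); and `T_(α; A) ∘ T_(β; B) = T_(1; E ∘ F)` with `E = χ_{α}(A)`, `F = χ_{β}(B)`. -/
def Compatibility : Prop :=
  (∀ (A B C : Obs) (f g : ℝ → ℝ), S.IsFunctionVia f C A → S.IsFunctionVia g C B →
      ∀ ρ, ρ ≠ S.null → ∀ Δ ⊆ S.spectrum A, ∀ Γ ⊆ S.spectrum B,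
        S.seqProb [(Δ, A), (Γ, B)] ρ =
          (S.prob ρ C).real (S.spectrum C ∩ (f ⁻¹' Δ ∩ g ⁻¹' Γ))) ∧
    ∀ A B, S.Compatible A B → ∀ α ∈ S.spectrum A, ∀ β ∈ S.spectrum B, ∀ E F G,
      S.IsChar {α} A E → S.IsChar {β} B F → S.IsProduct E F G →
        ∀ ρ, S.update {α} A (S.update {β} B ρ) = S.update {1} G ρ

/-- Only compatible observables commute. -/
def Commutativity : Prop :=
  ∀ A B, S.Commutes A B → S.Compatible A B

/-- If the pure state `T_(1; F) ω` predicts the outcome of `A` with certainty, then `F` and `A` are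
compatible; and only pure states predict outcomes of nondegenerate observables with certainty. -/
def Eigenstates : Prop :=
  (∀ ω, S.IsCompletelyMixed ω → ∀ F, S.IsProjectionOfRank 1 F → ∀ A, ∀ α ∈ S.spectrum A,
      (S.prob (S.update {1} F ω) A).real {α} = 1 → S.Compatible F A) ∧
    ∀ A, S.IsNondegenerate A → ∀ α ∈ S.spectrum A, ∀ ρ, ρ ≠ S.null →
      (S.prob ρ A).real {α} = 1 → S.IsPure ρ

/-- Symmetry of transition probabilities between rank-one projections:
`P(E → F) = P(F → E)`, where `P(E → F)` is the probability of `(1; F)` in the state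
`T_(1; E) ω`. -/
def TransitionSymmetry : Prop :=
  ∀ ω, S.IsCompletelyMixed ω → ∀ E F, S.IsProjectionOfRank 1 E → S.IsProjectionOfRank 1 F →
    (S.prob (S.update {1} E ω) F).real {1} = (S.prob (S.update {1} F ω) E).real {1}

end

end PhysicalSystem

namespace PhysicalSystem

section

variable {Obs State : Type*} {S : PhysicalSystem Obs State}

/-- The probability of a sequence of outcomes `(α₁; A₁), …, (αₘ; Aₘ)` in the state `ρ`. -/
noncomputable def outcomeProb (S : PhysicalSystem Obs State) (l : List (ℝ × Obs)) (ρ : State) : ℝ :=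
  S.seqProb (l.map fun e => (({e.1} : Set ℝ), e.2)) ρ

@[simp] lemma outcomeProb_nil (ρ : State) : S.outcomeProb [] ρ = 1 := rfl

lemma outcomeProb_cons (a : ℝ) (A : Obs) (l : List (ℝ × Obs)) (ρ : State) :
    S.outcomeProb ((a, A) :: l) ρ =
      (S.prob ρ A).real {a} * S.outcomeProb l (S.update {a} A ρ) := rfl

lemma outcomeProb_singleton (a : ℝ) (A : Obs) (ρ : State) :
    S.outcomeProb [(a, A)] ρ = (S.prob ρ A).real {a} := by
  simp [outcomeProb_cons]

lemma outcomeProb_pair (a b : ℝ) (A B : Obs) (ρ : State) :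
    S.outcomeProb [(a, A), (b, B)] ρ =
      (S.prob ρ A).real {a} * (S.prob (S.update {a} A ρ) B).real {b} := by
  simp [outcomeProb_cons]

lemma outcomeProb_cons_cons (a b : ℝ) (A B : Obs) (l : List (ℝ × Obs)) (ρ : State) :
    S.outcomeProb ((a, A) :: (b, B) :: l) ρ =
      S.outcomeProb [(a, A), (b, B)] ρ *
        S.outcomeProb l (S.update {b} B (S.update {a} A ρ)) := by
  simp only [outcomeProb_cons, outcomeProb_nil, mul_one, mul_assoc]

lemma outcomeProb_cons_congr (e : ℝ × Obs) {l l' : List (ℝ × Obs)}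
    (h : ∀ ρ, S.outcomeProb l ρ = S.outcomeProb l' ρ) (ρ : State) :
    S.outcomeProb (e :: l) ρ = S.outcomeProb (e :: l') ρ := by
  obtain ⟨a, A⟩ := e
  rw [outcomeProb_cons, outcomeProb_cons, h]

lemma real_prob_null (A : Obs) (Δ : Set ℝ) : (S.prob S.null A).real Δ = 0 := by
  simp [S.prob_null]

lemma real_prob_le_one (ρ : State) (A : Obs) (Δ : Set ℝ) : (S.prob ρ A).real Δ ≤ 1 := by
  by_cases hρ : ρ = S.null
  · subst hρ; simp [real_prob_null]
  · have := S.isProbabilityMeasure_prob ρ A hρ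
    exact measureReal_le_one

lemma isFiniteMeasure_prob (ρ : State) (A : Obs) : IsFiniteMeasure (S.prob ρ A) := by
  by_cases hρ : ρ = S.null
  · subst hρ; rw [S.prob_null]; infer_instance
  · have := S.isProbabilityMeasure_prob ρ A hρ
    infer_instance

lemma real_prob_eq_sum (ρ : State) (A : Obs) (Δ : Finset ℝ) :
    (S.prob ρ A).real Δ = ∑ a ∈ Δ, (S.prob ρ A).real {a} := by
  have := S.isFiniteMeasure_prob ρ A
  exact (sum_measureReal_singleton Δ).symm

lemma exists_real_prob_ne_zero {A : Obs} {a : ℝ}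
    (ha : a ∈ S.spectrum A) : ∃ ρ, (S.prob ρ A).real {a} ≠ 0 := by
  by_contra! hz
  refine (Set.mem_sInter.mp ha {a}ᶜ ⟨(measurableSet_singleton a).compl, fun ρ hρ => ?_⟩) rfl
  have := S.isProbabilityMeasure_prob ρ A hρ
  rw [prob_compl_eq_one_iff (measurableSet_singleton a)]
  exact (measureReal_eq_zero_iff).mp (hz ρ)

lemma outcomeProb_null (e : ℝ × Obs) (l : List (ℝ × Obs)) :
    S.outcomeProb (e :: l) S.null = 0 := by
  obtain ⟨a, A⟩ := e
  rw [outcomeProb_cons, real_prob_null, zero_mul]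

namespace IsFiniteDimensional

lemma real_prob_spectrum_inter (h : S.IsFiniteDimensional) (ρ : State) (A : Obs) (Δ : Set ℝ) :
    (S.prob ρ A).real (S.spectrum A ∩ Δ) = (S.prob ρ A).real Δ := by
  by_cases hρ : ρ = S.null
  · subst hρ; simp [real_prob_null]
  · have := S.isProbabilityMeasure_prob ρ A hρ
    have hae : S.spectrum A ∈ ae (S.prob ρ A) := by
      rw [mem_ae_iff, prob_compl_eq_zero_iff (h.finite_spectrum A).measurableSet]
      exact h.prob_spectrum A ρ hρ
    apply measureReal_congr
    filter_upwards [hae] with x hx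
    exact propext ⟨fun h => h.2, fun h => ⟨hx, h⟩⟩

lemma real_prob_eq_zero (h : S.IsFiniteDimensional) {A : Obs} {a : ℝ} (ha : a ∉ S.spectrum A)
    (ρ : State) : (S.prob ρ A).real {a} = 0 := by
  rw [← h.real_prob_spectrum_inter, Set.inter_singleton_eq_empty.mpr ha, measureReal_empty]

lemma sum_real_prob (h : S.IsFiniteDimensional) {ρ : State} (hρ : ρ ≠ S.null) (A : Obs) :
    ∑ a ∈ (h.finite_spectrum A).toFinset, (S.prob ρ A).real {a} = 1 := by
  rw [← real_prob_eq_sum, Set.Finite.coe_toFinset, measureReal_def, h.prob_spectrum A ρ hρ,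
    ENNReal.toReal_one]

end IsFiniteDimensional

lemma isFunctionVia_id (A : Obs) : S.IsFunctionVia id A A :=
  ⟨fun _ h => h, fun _ _ Γ hΓ => by rw [Set.preimage_id, Set.inter_eq_right.mpr hΓ]⟩

lemma Compatible.refl (A : Obs) : S.Compatible A A :=
  ⟨A, id, id, isFunctionVia_id A, isFunctionVia_id A⟩

lemma Compatible.symm {A B : Obs} (h : S.Compatible A B) : S.Compatible B A := by
  obtain ⟨C, f, g, hf, hg⟩ := h
  exact ⟨C, g, f, hg, hf⟩

lemma IsProduct.symm {E F G : Obs} (h : S.IsProduct E F G) : S.IsProduct F E G := by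
  obtain ⟨C, Δ, Γ, hE, hF, hG⟩ := h
  exact ⟨C, Γ, Δ, hF, hE, Set.inter_comm Δ Γ ▸ hG⟩

namespace IsFunctionVia

variable {A B D : Obs} {f g h : ℝ → ℝ}

lemma real_prob_eq (hf : S.IsFunctionVia f A B) (hfin : S.IsFiniteDimensional) (ρ : State)
    (Γ : Set ℝ) : (S.prob ρ B).real Γ = (S.prob ρ A).real (f ⁻¹' Γ) := by
  by_cases hρ : ρ = S.null
  · subst hρ; simp [real_prob_null]
  · rw [← hfin.real_prob_spectrum_inter ρ B, hf.2 ρ hρ _ Set.inter_subset_left,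
      ← hfin.real_prob_spectrum_inter ρ A (f ⁻¹' Γ)]
    congr 1
    ext x
    exact ⟨fun hx => ⟨hx.1, hx.2.2⟩, fun hx => ⟨hx.1, hf.1 hx.1, hx.2⟩⟩

lemma surjOn (hf : S.IsFunctionVia f A B) (hfin : S.IsFiniteDimensional) :
    Set.SurjOn f (S.spectrum A) (S.spectrum B) := by
  intro b hb
  obtain ⟨ρ, hρ⟩ := exists_real_prob_ne_zero hb
  rw [hf.real_prob_eq hfin, ← hfin.real_prob_spectrum_inter] at hρ
  by_contra hne
  refine hρ ?_
  rw [show S.spectrum A ∩ f ⁻¹' {b} = ∅ from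
    Set.eq_empty_iff_forall_notMem.mpr fun x hx => hne ⟨x, hx.1, hx.2⟩, measureReal_empty]

lemma factor (hf : S.IsFunctionVia f A B) (hh : S.IsFunctionVia h A D)
    (hfin : S.IsFiniteDimensional) (heq : ∀ x ∈ S.spectrum A, g (f x) = h x) :
    S.IsFunctionVia g B D := by
  refine ⟨fun b hb => ?_, fun ρ _ Γ _ => ?_⟩
  · obtain ⟨x, hx, rfl⟩ := hf.surjOn hfin hb
    rw [heq x hx]
    exact hh.1 hx
  · rw [hfin.real_prob_spectrum_inter, hf.real_prob_eq hfin, hh.real_prob_eq hfin,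
      ← hfin.real_prob_spectrum_inter, ← hfin.real_prob_spectrum_inter ρ A (f ⁻¹' _)]
    congr 1
    ext x
    refine and_congr_right fun hx => ?_
    simp only [Set.mem_preimage, heq x hx]

lemma comp (hg : S.IsFunctionVia g B D) (hf : S.IsFunctionVia f A B)
    (hfin : S.IsFiniteDimensional) : S.IsFunctionVia (g ∘ f) A D := by
  refine ⟨hg.1.comp hf.1, fun ρ _ Γ _ => ?_⟩
  rw [hfin.real_prob_spectrum_inter, hg.real_prob_eq hfin, hf.real_prob_eq hfin,
    Set.preimage_comp]

lemma congr (hf : S.IsFunctionVia f A B) (heq : Set.EqOn f g (S.spectrum A)) :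
    S.IsFunctionVia g A B := by
  refine ⟨fun x hx => heq hx ▸ hf.1 hx, fun ρ hρ Γ hΓ => ?_⟩
  rw [hf.2 ρ hρ Γ hΓ]
  congr 1
  ext x
  refine and_congr_right fun hx => ?_
  simp only [Set.mem_preimage, heq hx]

end IsFunctionVia

lemma ObservablesAndStates.exists_isFunctionVia (hobs : S.ObservablesAndStates)
    (hfin : S.IsFiniteDimensional) (A : Obs) (f : ℝ → ℝ) : ∃ B, S.IsFunctionVia f A B := by
  by_cases hA : S.IsNondegenerate A
  · exact hobs.2.1 A hA f
  · obtain ⟨C, g, hC, hg, -⟩ := hobs.1 A hA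
    obtain ⟨B, hB⟩ := hobs.2.1 C hC (f ∘ g)
    exact ⟨B, hg.factor hB hfin fun _ _ => rfl⟩

lemma ObservablesAndStates.exists_isChar (hobs : S.ObservablesAndStates)
    (hfin : S.IsFiniteDimensional) {A : Obs} {Δ : Set ℝ} (hΔ : Δ ⊆ S.spectrum A) :
    ∃ E, S.IsChar Δ A E := by
  obtain ⟨E, hE⟩ := hobs.exists_isFunctionVia hfin A (Δ.indicator fun _ => 1)
  exact ⟨E, hΔ, hE⟩

namespace IsChar

variable {A C E : Obs} {Δ : Set ℝ} {f : ℝ → ℝ}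

lemma spectrum_subset (hE : S.IsChar Δ A E) (hfin : S.IsFiniteDimensional) :
    S.spectrum E ⊆ {0, 1} := by
  intro x hx
  obtain ⟨c, -, rfl⟩ := hE.2.surjOn hfin hx
  by_cases hc : c ∈ Δ <;> simp [hc]

lemma real_prob_one (hE : S.IsChar Δ A E) (hfin : S.IsFiniteDimensional) (ρ : State) :
    (S.prob ρ E).real {1} = (S.prob ρ A).real Δ := by
  rw [hE.2.real_prob_eq hfin]
  congr 1
  ext x
  by_cases hx : x ∈ Δ <;> simp [hx]

/-- If `A = f(C)`, then `χ_Δ(A) = χ_{f ∈ Δ}(C)`. -/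
lemma pullback (hE : S.IsChar Δ A E) (hf : S.IsFunctionVia f C A)
    (hfin : S.IsFiniteDimensional) : S.IsChar (S.spectrum C ∩ f ⁻¹' Δ) C E := by
  refine ⟨Set.inter_subset_left, (hE.2.comp hf hfin).congr fun x hx => ?_⟩
  by_cases hx' : f x ∈ Δ <;> simp [hx, hx']

end IsChar

/-- The postulates about measurements and updates used in the proof of local orthogonality. -/
structure MeasurementPostulates (S : PhysicalSystem Obs State) : Prop where
  fin : S.IsFiniteDimensional
  subj : S.SubjectiveUpdate
  self : S.SelfCompatibility
  obs : S.ObservablesAndStates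
  compat : S.Compatibility
  comm : S.Commutativity

namespace MeasurementPostulates

variable (h : S.MeasurementPostulates)
include h

lemma outcomeProb_eq_zero {a : ℝ} {A : Obs} (ha : a ∉ S.spectrum A) (l : List (ℝ × Obs))
    (ρ : State) : S.outcomeProb ((a, A) :: l) ρ = 0 := by
  rw [outcomeProb_cons, h.fin.real_prob_eq_zero ha, zero_mul]

lemma update_ne_null {a : ℝ} {A : Obs} {ρ : State} (hρ : ρ ≠ S.null)
    (ha : (S.prob ρ A).real {a} ≠ 0) : S.update {a} A ρ ≠ S.null := by
  intro hn
  have hmem : a ∈ S.spectrum A := by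
    by_contra hmem
    exact ha (h.fin.real_prob_eq_zero hmem ρ)
  have := (h.self A a hmem).1 ρ hρ {a} (Set.singleton_subset_iff.mpr hmem)
  rw [hn, real_prob_null, Set.inter_self, div_self ha] at this
  exact zero_ne_one this

lemma outcomeProb_idem (a : ℝ) (A : Obs) (l : List (ℝ × Obs)) (ρ : State) :
    S.outcomeProb ((a, A) :: (a, A) :: l) ρ = S.outcomeProb ((a, A) :: l) ρ := by
  by_cases ha : a ∈ S.spectrum A
  swap
  · rw [h.outcomeProb_eq_zero ha, h.outcomeProb_eq_zero ha]
  by_cases hρ : ρ = S.null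
  · subst hρ; rw [outcomeProb_null, outcomeProb_null]
  rw [outcomeProb_cons, outcomeProb_cons, outcomeProb_cons, (h.self A a ha).2.1,
    (h.self A a ha).1 ρ hρ {a} (Set.singleton_subset_iff.mpr ha), Set.inter_self, ← mul_assoc]
  by_cases hz : (S.prob ρ A).real {a} = 0
  · simp [hz]
  · rw [div_self hz, mul_one]

lemma outcomeProb_exclusive {a a' : ℝ} (hne : a ≠ a') (A : Obs) (l : List (ℝ × Obs))
    (ρ : State) : S.outcomeProb ((a, A) :: (a', A) :: l) ρ = 0 := by
  by_cases ha : a ∈ S.spectrum A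
  swap
  · rw [h.outcomeProb_eq_zero ha]
  by_cases ha' : a' ∈ S.spectrum A
  swap
  · rw [outcomeProb_cons, h.outcomeProb_eq_zero ha', mul_zero]
  by_cases hρ : ρ = S.null
  · subst hρ; rw [outcomeProb_null]
  rw [outcomeProb_cons, outcomeProb_cons,
    (h.self A a ha).1 ρ hρ {a'} (Set.singleton_subset_iff.mpr ha'),
    Set.singleton_inter_eq_empty.mpr (fun hh => hne hh.symm)]
  simp

lemma outcomeProb_pair_eq {A B C : Obs} {f g : ℝ → ℝ} (hf : S.IsFunctionVia f C A)
    (hg : S.IsFunctionVia g C B) (a b : ℝ) (ρ : State) :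
    S.outcomeProb [(a, A), (b, B)] ρ = (S.prob ρ C).real (f ⁻¹' {a} ∩ g ⁻¹' {b}) := by
  have := S.isFiniteMeasure_prob ρ C
  by_cases ha : a ∈ S.spectrum A
  swap
  · rw [h.outcomeProb_eq_zero ha]
    refine (measureReal_mono_null Set.inter_subset_left ?_).symm
    rw [← hf.real_prob_eq h.fin, h.fin.real_prob_eq_zero ha]
  by_cases hb : b ∈ S.spectrum B
  swap
  · rw [outcomeProb_cons, h.outcomeProb_eq_zero hb, mul_zero]
    refine (measureReal_mono_null Set.inter_subset_right ?_).symm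
    rw [← hg.real_prob_eq h.fin, h.fin.real_prob_eq_zero hb]
  by_cases hρ : ρ = S.null
  · subst hρ; rw [outcomeProb_null, real_prob_null]
  rw [← h.fin.real_prob_spectrum_inter]
  exact h.compat.1 A B C f g hf hg ρ hρ {a} (Set.singleton_subset_iff.mpr ha) {b}
    (Set.singleton_subset_iff.mpr hb)

/-- Successive outcomes of `A = f(C)` and `B = g(C)` amount to the single outcome `1` of
`χ_{f = a, g = b}(C)`. -/
lemma outcomeProb_product {A B C G : Obs} {f g : ℝ → ℝ} (hf : S.IsFunctionVia f C A)
    (hg : S.IsFunctionVia g C B) {a b : ℝ}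
    (hG : S.IsChar (S.spectrum C ∩ (f ⁻¹' {a} ∩ g ⁻¹' {b})) C G) (l : List (ℝ × Obs))
    (ρ : State) :
    S.outcomeProb ((a, A) :: (b, B) :: l) ρ = S.outcomeProb ((1, G) :: l) ρ := by
  have hp : S.outcomeProb [(a, A), (b, B)] ρ = (S.prob ρ G).real {1} := by
    rw [h.outcomeProb_pair_eq hf hg, hG.real_prob_one h.fin, h.fin.real_prob_spectrum_inter]
  rw [outcomeProb_cons_cons, hp, outcomeProb_cons]
  by_cases hz : (S.prob ρ G).real {1} = 0
  · rw [hz, zero_mul, zero_mul]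
  have ha : a ∈ S.spectrum A := by
    by_contra ha
    exact hz (hp ▸ h.outcomeProb_eq_zero ha _ _)
  have hb : b ∈ S.spectrum B := by
    by_contra hb
    exact hz (hp ▸ by rw [outcomeProb_cons, h.outcomeProb_eq_zero hb, mul_zero])
  obtain ⟨E, hE⟩ := h.obs.exists_isChar h.fin (Set.singleton_subset_iff.mpr ha)
  obtain ⟨F, hF⟩ := h.obs.exists_isChar h.fin (Set.singleton_subset_iff.mpr hb)
  rw [h.compat.2 B A ⟨C, g, f, hg, hf⟩ b hb a ha F E G hF hE ?_]
  refine IsProduct.symm ⟨C, _, _, hE.pullback hf h.fin, hF.pullback hg h.fin, ?_⟩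
  rwa [← Set.inter_inter_distrib_left]

lemma outcomeProb_swap {A B : Obs} (hAB : S.Compatible A B) (a b : ℝ) (l : List (ℝ × Obs))
    (ρ : State) :
    S.outcomeProb ((a, A) :: (b, B) :: l) ρ = S.outcomeProb ((b, B) :: (a, A) :: l) ρ := by
  obtain ⟨C, f, g, hf, hg⟩ := hAB
  obtain ⟨G, hG⟩ := h.obs.exists_isChar h.fin
    (Set.inter_subset_left : S.spectrum C ∩ (f ⁻¹' {a} ∩ g ⁻¹' {b}) ⊆ S.spectrum C)
  rw [h.outcomeProb_product hf hg hG, h.outcomeProb_product hg hf (Set.inter_comm (f ⁻¹' {a}) _ ▸ hG)]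

/-- An outcome of `X` implied by a compatible outcome of `Y` does not disturb the latter. -/
lemma outcomeProb_absorb {X Y : Obs} (hXY : S.Compatible X Y) {x y : ℝ}
    (hzero : ∀ x' ∈ S.spectrum X, x' ≠ x → ∀ ρ, S.outcomeProb [(x', X), (y, Y)] ρ = 0)
    (l : List (ℝ × Obs)) (ρ : State) :
    S.outcomeProb ((x, X) :: (y, Y) :: l) ρ = S.outcomeProb ((y, Y) :: l) ρ := by
  obtain ⟨C, f, g, hf, hg⟩ := hXY
  have himp : ∀ c ∈ S.spectrum C, g c = y → f c = x := by
    intro c hc hgc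
    by_contra hne
    obtain ⟨ρ, hρ⟩ := exists_real_prob_ne_zero hc
    have := S.isFiniteMeasure_prob ρ C
    have h0 := hzero (f c) (hf.1 hc) hne ρ
    rw [h.outcomeProb_pair_eq hf hg] at h0
    refine hρ (measureReal_mono_null (Set.singleton_subset_iff.mpr ?_) h0)
    exact ⟨rfl, hgc⟩
  have hset : S.spectrum C ∩ (f ⁻¹' {x} ∩ g ⁻¹' {y}) =
      S.spectrum C ∩ (g ⁻¹' {y} ∩ g ⁻¹' {y}) := by
    ext c
    exact ⟨fun hc => ⟨hc.1, hc.2.2, hc.2.2⟩, fun hc => ⟨hc.1, himp c hc.1 hc.2.1, hc.2.1⟩⟩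
  obtain ⟨G, hG⟩ := h.obs.exists_isChar h.fin
    (Set.inter_subset_left : S.spectrum C ∩ (f ⁻¹' {x} ∩ g ⁻¹' {y}) ⊆ S.spectrum C)
  rw [h.outcomeProb_product hf hg hG, ← h.outcomeProb_idem y Y,
    h.outcomeProb_product hg hg (hset ▸ hG)]

lemma sum_outcomeProb_append (A : Obs) (l : List (ℝ × Obs)) {ρ : State} (hρ : ρ ≠ S.null) :
    ∑ a ∈ (h.fin.finite_spectrum A).toFinset, S.outcomeProb (l ++ [(a, A)]) ρ =
      S.outcomeProb l ρ := by
  induction l generalizing ρ with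
  | nil => simpa [outcomeProb_singleton] using h.fin.sum_real_prob hρ A
  | cons e l ih =>
    obtain ⟨b, B⟩ := e
    simp only [List.cons_append, outcomeProb_cons, ← Finset.mul_sum]
    by_cases hz : (S.prob ρ B).real {b} = 0
    · simp [hz]
    · rw [ih (h.update_ne_null hρ hz)]

lemma real_prob_mul_update {A B : Obs} {ρ : State} (hρ : ρ ≠ S.null) {Δ Γ : Finset ℝ}
    (hΔ : (Δ : Set ℝ) ⊆ S.spectrum A) (hΓ : (Γ : Set ℝ) ⊆ S.spectrum B) :
    (S.prob ρ A).real Δ * (S.prob (S.update Δ A ρ) B).real Γ =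
      ∑ a ∈ Δ, ∑ b ∈ Γ, S.outcomeProb [(a, A), (b, B)] ρ := by
  have := S.isFiniteMeasure_prob ρ A
  have hup := h.subj.2 A Δ hΔ ρ hρ [((Γ : Set ℝ), B)] (List.cons_ne_nil _ _)
    (by simpa using hΓ)
  simp only [seqProb, mul_one] at hup
  rw [hup, Finset.mul_sum]
  refine Finset.sum_congr rfl fun a ha => ?_
  simp only [outcomeProb_pair]
  rw [← Finset.mul_sum, ← real_prob_eq_sum, ← mul_assoc]
  congr 1
  by_cases hz : (S.prob ρ A).real Δ = 0
  · rw [hz, zero_mul]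
    refine (measureReal_mono_null (Set.singleton_subset_iff.mpr ?_) hz).symm
    exact ha
  · rw [mul_div_cancel₀ _ hz]

lemma compatible_of_outcomeProb_swap {A B : Obs}
    (hs : ∀ ρ, ρ ≠ S.null → ∀ a ∈ S.spectrum A, ∀ b ∈ S.spectrum B,
      S.outcomeProb [(a, A), (b, B)] ρ = S.outcomeProb [(b, B), (a, A)] ρ) :
    S.Compatible A B := by
  refine h.comm A B fun ρ hρ Δ hΔ Γ hΓ => ?_
  lift Δ to Finset ℝ using (h.fin.finite_spectrum A).subset hΔ
  lift Γ to Finset ℝ using (h.fin.finite_spectrum B).subset hΓ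
  rw [h.real_prob_mul_update hρ hΔ hΓ, h.real_prob_mul_update hρ hΓ hΔ, Finset.sum_comm]
  exact Finset.sum_congr rfl fun b hb => Finset.sum_congr rfl fun a ha =>
    hs ρ hρ a (hΔ ha) b (hΓ hb)

lemma outcomeProb_exclusive_of_mem {x x' : ℝ} {X : Obs} (hx : x ≠ x') {l : List (ℝ × Obs)}
    (hmem : (x', X) ∈ l) (hl : ∀ e ∈ l, S.Compatible X e.2) (ρ : State) :
    S.outcomeProb ((x, X) :: l) ρ = 0 := by
  induction l generalizing ρ with
  | nil => simp at hmem
  | cons e l ih =>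
    obtain ⟨b, B⟩ := e
    rcases List.mem_cons.mp hmem with heq | hmem
    · obtain ⟨rfl, rfl⟩ := Prod.mk.inj heq
      exact h.outcomeProb_exclusive hx X l ρ
    · rw [h.outcomeProb_swap (hl (b, B) List.mem_cons_self), outcomeProb_cons,
        ih hmem fun e he => hl e (List.mem_cons_of_mem _ he), mul_zero]

/-- Observing in advance an outcome that belongs to a sequence of compatible outcomes does not
change the probability of the sequence. -/
lemma outcomeProb_cons_of_mem {x : ℝ} {X : Obs} {l : List (ℝ × Obs)}
    (hmem : (x, X) ∈ l) (hl : ∀ e ∈ l, S.Compatible X e.2) (ρ : State) :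
    S.outcomeProb ((x, X) :: l) ρ = S.outcomeProb l ρ := by
  induction l generalizing ρ with
  | nil => simp at hmem
  | cons e l ih =>
    obtain ⟨b, B⟩ := e
    rcases List.mem_cons.mp hmem with heq | hmem
    · obtain ⟨rfl, rfl⟩ := Prod.mk.inj heq
      exact h.outcomeProb_idem x X l ρ
    · rw [h.outcomeProb_swap (hl (b, B) List.mem_cons_self)]
      exact outcomeProb_cons_congr _
        (ih hmem fun e he => hl e (List.mem_cons_of_mem _ he)) ρ

/-- Moving an outcome past two compatible ones. -/
lemma outcomeProb_rotate {A B Z : Obs} (hA : S.Compatible A Z) (hB : S.Compatible B Z)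
    (a b z : ℝ) (l : List (ℝ × Obs)) (ρ : State) :
    S.outcomeProb ((a, A) :: (b, B) :: (z, Z) :: l) ρ =
      S.outcomeProb ((z, Z) :: (a, A) :: (b, B) :: l) ρ := by
  rw [outcomeProb_cons_congr _ (h.outcomeProb_swap hB b z l), h.outcomeProb_swap hA]

/-- The product of two compatible events is compatible with everything both observables are
compatible with. -/
lemma exists_product {A B : Obs} (hAB : S.Compatible A B) (a b : ℝ) :
    ∃ G, S.spectrum G ⊆ {0, 1} ∧
      (∀ l ρ, S.outcomeProb ((a, A) :: (b, B) :: l) ρ = S.outcomeProb ((1, G) :: l) ρ) ∧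
      ∀ Z, S.Compatible A Z → S.Compatible B Z → S.Compatible G Z := by
  have hAB' := hAB
  obtain ⟨C, f, g, hf, hg⟩ := hAB
  have hchar (a' b' : ℝ) := h.obs.exists_isChar h.fin
    (Set.inter_subset_left : S.spectrum C ∩ (f ⁻¹' {a'} ∩ g ⁻¹' {b'}) ⊆ S.spectrum C)
  obtain ⟨G, hG⟩ := hchar a b
  have hprod := h.outcomeProb_product hf hg hG
  have hspec := hG.spectrum_subset h.fin
  refine ⟨G, hspec, hprod, fun Z hAZ hBZ => ?_⟩
  have hone (z : ℝ) (l : List (ℝ × Obs)) (ρ : State) :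
      S.outcomeProb ((1, G) :: (z, Z) :: l) ρ = S.outcomeProb ((z, Z) :: (1, G) :: l) ρ := by
    rw [← hprod, h.outcomeProb_rotate hAZ hBZ]
    exact outcomeProb_cons_congr _ (hprod l) ρ
  refine h.compatible_of_outcomeProb_swap fun ρ hρ x hx z hz => ?_
  obtain rfl | rfl : x = 0 ∨ x = 1 := hspec hx
  swap
  · exact hone z [] ρ
  -- the terms of the expansion of `P(G = 0, Z = z)` over the outcomes of `A` and `B`
  have hterm (a' b' : ℝ) :
      S.outcomeProb [(0, G), (z, Z), (a', A), (b', B)] ρ =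
        S.outcomeProb [(z, Z), (a', A), (b', B)] ρ -
          if a' = a ∧ b' = b then S.outcomeProb [(z, Z), (a, A), (b, B)] ρ else 0 := by
    rw [outcomeProb_cons_congr _ fun ρ => (h.outcomeProb_rotate hAZ hBZ a' b' z [] ρ).symm]
    split_ifs with hab
    · obtain ⟨rfl, rfl⟩ := hab
      rw [sub_self, outcomeProb_cons_congr _ (hprod _),
        h.outcomeProb_exclusive zero_ne_one]
    · obtain ⟨H, hH⟩ := hchar a' b'
      have hprodH := h.outcomeProb_product hf hg hH
      rw [sub_zero, outcomeProb_cons_congr _ (hprodH _),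
        h.outcomeProb_absorb ⟨C, _, _, hG.2, hH.2⟩, ← hprodH, h.outcomeProb_rotate hAZ hBZ]
      intro x' hx' hne ρ
      obtain rfl : x' = 1 := (hspec hx').resolve_left hne
      rw [← hprod, outcomeProb_cons_congr _
        (outcomeProb_cons_congr _ fun ρ => (hprodH [] ρ).symm)]
      by_cases ha : a' = a
      · have hb : b ≠ b' := fun hb => hab ⟨ha, hb.symm⟩
        rw [outcomeProb_cons, h.outcomeProb_exclusive_of_mem (x' := b') hb, mul_zero]
        · simp
        · simp [hAB'.symm, Compatible.refl]
      · rw [h.outcomeProb_exclusive_of_mem (x' := a') (Ne.symm ha)]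
        · simp
        · simp [hAB', Compatible.refl]
  have htotal (l : List (ℝ × Obs)) : ∑ a' ∈ (h.fin.finite_spectrum A).toFinset,
      ∑ b' ∈ (h.fin.finite_spectrum B).toFinset, S.outcomeProb (l ++ [(a', A), (b', B)]) ρ =
        S.outcomeProb l ρ := by
    rw [← h.sum_outcomeProb_append A l hρ]
    refine Finset.sum_congr rfl fun a' _ => ?_
    simpa using h.sum_outcomeProb_append B (l ++ [(a', A)]) hρ
  have hsum : ∑ a' ∈ (h.fin.finite_spectrum A).toFinset,
      ∑ b' ∈ (h.fin.finite_spectrum B).toFinset,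
        (if a' = a ∧ b' = b then S.outcomeProb [(z, Z), (a, A), (b, B)] ρ else 0) =
          S.outcomeProb [(z, Z), (1, G)] ρ := by
    rw [← outcomeProb_cons_congr _ (hprod [])]
    by_cases ha : a ∈ S.spectrum A
    · by_cases hb : b ∈ S.spectrum B
      · simp [ite_and, ha, hb]
      · simp [outcomeProb_cons, h.fin.real_prob_eq_zero hb]
    · simp [outcomeProb_cons, h.fin.real_prob_eq_zero ha]
  have hG01 : S.outcomeProb [(z, Z), (0, G)] ρ + S.outcomeProb [(z, Z), (1, G)] ρ =
      S.outcomeProb [(z, Z)] ρ := by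
    rw [← h.sum_outcomeProb_append G [(z, Z)] hρ,
      Finset.sum_subset (s₂ := {0, 1}) (fun x hx => by simpa using hspec (by simpa using hx)),
      Finset.sum_pair zero_ne_one]
    · rfl
    · intro x _ hx
      rw [List.cons_append, outcomeProb_cons, List.nil_append,
        h.outcomeProb_eq_zero (by simpa using hx), mul_zero]
  rw [eq_sub_of_add_eq hG01, ← htotal [(0, G), (z, Z)], ← htotal [(z, Z)], ← hsum]
  simp only [← Finset.sum_sub_distrib]
  exact Finset.sum_congr rfl fun a' _ => Finset.sum_congr rfl fun b' _ => hterm a' b'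

/-- A nonempty sequence of outcomes of pairwise compatible observables amounts to the outcome `1`
of a single projection. -/
lemma exists_projection {l : List (ℝ × Obs)} (hne : l ≠ [])
    (hl : ∀ e ∈ l, ∀ e' ∈ l, S.Compatible e.2 e'.2) :
    ∃ G, S.spectrum G ⊆ {0, 1} ∧
      (∀ l' ρ, S.outcomeProb (l ++ l') ρ = S.outcomeProb ((1, G) :: l') ρ) ∧
      ∀ Z, (∀ e ∈ l, S.Compatible e.2 Z) → S.Compatible G Z := by
  induction l with
  | nil => exact absurd rfl hne
  | cons e l ih =>
    obtain ⟨a, A⟩ := e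
    by_cases hnil : l = []
    · subst hnil
      obtain ⟨G, hspec, hG, hcomp⟩ := h.exists_product (Compatible.refl A) a a
      refine ⟨G, hspec, fun l' ρ => ?_, fun Z hZ => ?_⟩
      · rw [← hG, h.outcomeProb_idem]
        rfl
      · exact hcomp Z (hZ _ List.mem_cons_self) (hZ _ List.mem_cons_self)
    · obtain ⟨G', -, hG', hcomp'⟩ := ih hnil fun e he e' he' =>
        hl e (List.mem_cons_of_mem _ he) e' (List.mem_cons_of_mem _ he')
      have hAG : S.Compatible A G' := (hcomp' A fun e he =>
        hl e (List.mem_cons_of_mem _ he) (a, A) List.mem_cons_self).symm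
      obtain ⟨G, hspec, hG, hcomp⟩ := h.exists_product hAG a 1
      refine ⟨G, hspec, fun l' ρ => ?_, fun Z hZ => hcomp Z (hZ _ List.mem_cons_self)
        (hcomp' Z fun e he => hZ e (List.mem_cons_of_mem _ he))⟩
      rw [← hG, List.cons_append]
      exact outcomeProb_cons_congr _ (hG' l') ρ

/-- Local orthogonality for lists of outcomes. -/
lemma sum_outcomeProb_le_one {ι : Type*} (s : Finset ι) (L : ι → List (ℝ × Obs))
    (hne : ∀ j, L j ≠ []) (hcomp : ∀ j, ∀ e ∈ L j, ∀ e' ∈ L j, S.Compatible e.2 e'.2)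
    (hdist : ∀ j j', j ≠ j' → ∃ X x x', x ≠ x' ∧ (x, X) ∈ L j ∧ (x', X) ∈ L j') (ρ : State) :
    ∑ j ∈ s, S.outcomeProb (L j) ρ ≤ 1 := by
  classical
  choose F hspec hF hFcomp using fun j => h.exists_projection (hne j) (hcomp j)
  have hFL (j : ι) (ρ : State) : S.outcomeProb (L j) ρ = (S.prob ρ (F j)).real {1} := by
    rw [← outcomeProb_singleton, ← hF, List.append_nil]
  have hundisturbed (j j' : ι) (hj : j ≠ j') (ρ : State) :
      S.outcomeProb ((0, F j') :: L j) ρ = S.outcomeProb (L j) ρ := by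
    obtain ⟨X, x, x', hx, hmem, hmem'⟩ := hdist j j' hj
    have hrep := h.outcomeProb_cons_of_mem hmem fun e he => hcomp j _ hmem e he
    have hFX : S.Compatible (F j') X := hFcomp j' X fun e he => hcomp j' e he _ hmem'
    rw [← hrep, outcomeProb_cons_congr _ fun ρ => (hrep ρ).symm,
      h.outcomeProb_absorb hFX]
    intro y hy hy0 ρ
    obtain rfl : y = 1 := (hspec j' hy).resolve_left hy0
    rw [h.outcomeProb_swap hFX, outcomeProb_cons_congr _ fun ρ => (hF j' [] ρ).symm,
      List.append_nil]
    exact h.outcomeProb_exclusive_of_mem hx hmem' (fun e he => hcomp j' _ hmem' e he) ρ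
  induction s using Finset.induction_on generalizing ρ with
  | empty => simp
  | insert j₀ s hj₀ ih =>
    rw [Finset.sum_insert hj₀, hFL, Finset.sum_congr rfl fun j hj =>
      (hundisturbed j j₀ (fun hh => hj₀ (hh ▸ hj)) ρ).symm]
    simp only [outcomeProb_cons]
    rw [← Finset.mul_sum]
    have h01 := real_prob_le_one (S := S) ρ (F j₀) (({1, 0} : Finset ℝ) : Set ℝ)
    rw [real_prob_eq_sum, Finset.sum_pair one_ne_zero] at h01
    have := mul_le_mul_of_nonneg_left (ih (S.update {0} (F j₀) ρ))
      (measureReal_nonneg (μ := S.prob ρ (F j₀)) (s := {0}))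
    linarith

end MeasurementPostulates

end

end PhysicalSystem

theorem mainTheorem8 {Obs State : Type*} (S : PhysicalSystem Obs State)
    (hfin : S.IsFiniteDimensional)
    (hsep : S.Separability) (hsubj : S.SubjectiveUpdate) (hself : S.SelfCompatibility)
    (hobs : S.ObservablesAndStates) (hcompat : S.Compatibility) (hcomm : S.Commutativity)
    (heig : S.Eigenstates) (htrans : S.TransitionSymmetry)
    {k m : ℕ} (A : Fin k → Fin m → Obs) (α : Fin k → Fin m → ℝ)
    (hA : ∀ j i i', i ≠ i' → S.Compatible (A j i) (A j i'))
    (hα : ∀ j i, α j i ∈ S.spectrum (A j i))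
    (hdist : ∀ j j', j ≠ j' → ∃ i, A j i = A j' i ∧ α j i ≠ α j' i)
    (ρ : State) (hρ : ρ ≠ S.null) :
    ∑ j, S.jointProb ρ (α j) (A j) ≤ 1 := by
  have h : S.MeasurementPostulates := ⟨hfin, hsubj, hself, hobs, hcompat, hcomm⟩
  have hjoint (j : Fin k) : S.jointProb ρ (α j) (A j) =
      S.outcomeProb (List.ofFn fun i => (α j i, A j i)) ρ := by
    rw [PhysicalSystem.outcomeProb, List.map_ofFn]
    rfl
  simp only [hjoint]
  obtain rfl | hm := Nat.eq_zero_or_pos m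
  · have hk : Subsingleton (Fin k) := ⟨fun j j' => by
      by_contra hj
      exact (hdist j j' hj).choose.elim0⟩
    have hcard : k ≤ 1 := by simpa using Fintype.card_le_one_iff_subsingleton.mpr hk
    simpa using hcard
  refine h.sum_outcomeProb_le_one Finset.univ _ (fun j hj => ?_) (fun j e he e' he' => ?_)
    (fun j j' hj => ?_) ρ
  · exact hm.ne' (List.ofFn_eq_nil_iff.mp hj)
  · obtain ⟨i, rfl⟩ := (List.mem_ofFn' _ _).mp he
    obtain ⟨i', rfl⟩ := (List.mem_ofFn' _ _).mp he'
    by_cases hi : i = i'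
    · subst hi; exact PhysicalSystem.Compatible.refl _
    · exact hA j i i' hi
  · obtain ⟨i, hAi, hαi⟩ := hdist j j' hj
    exact ⟨A j i, α j i, α j' i, hαi, (List.mem_ofFn' _ _).mpr ⟨i, rfl⟩,
      (List.mem_ofFn' _ _).mpr ⟨i, by rw [hAi]⟩⟩
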